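/- Let $n \ge 13$. A hidden tree $T$ on the vertex set $\{v_1,\dots,v_n\}$ is to be investigated by distance queries: a query is a pair of distinct vertices, and its answer is their distance in $T$. A non-adaptive algorithm asks all its queries at once, so it is given by a query graph $Q$ on $\{v_1,\dots,v_n\}$ whose edges are the queried pairs. A tree on $\{v_1,\dots,v_n\}$ is consistent with given answers if, for every edge $xy$ of $Q$, the distance of $x$ and $y$ in it is the answer to $xy$. We say that $Q$ finds a pair of vertices at maximum distance if, for every hidden tree, there are two vertices that are at maximum distance in every tree consistent with the answers. We say that $Q$ determines the hidden tree up to isomorphism if, for every hidden tree, all trees consistent with the answers are isomorphic. Let $f_N(n)$ and $h_N(n)$ be the minimum number of edges of a query graph on $n$ vertices that finds a pair of vertices at maximum distance, respectively that determines the hidden tree up to isomorphism. Then, for every graph $Q$ on $n$ vertices, the following are equivalent: 1. $Q$ finds a pair of vertices at maximum distance; 2. $Q$ determines the hidden tree up to isomorphism; 3. every vertex of $Q$ has degree at least $n-3$. Moreover, $f_N(n) = h_N(n) = \frac{n(n-3)}{2}$. -/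

import Mathlib

/-- `T` is a possible hidden tree once the edges of the query graph `Q` have received the answers
`q`: it is a tree, and each queried pair has in `T` the distance that was answered. -/
def IsConsistent {V : Type*} (Q : SimpleGraph V) (q : Sym2 V → ℕ) (T : SimpleGraph V) : Prop :=
  T.IsTree ∧ ∀ x y : V, Q.Adj x y → T.dist x y = q s(x, y)

/-- The vertices `x` and `y` are at maximum distance in `T`. -/
def IsMaxDistPair {V : Type*} (T : SimpleGraph V) (x y : V) : Prop :=
  ∀ u v : V, T.dist u v ≤ T.dist x y

/-- `Q` finds two vertices at maximum distance: whatever answers arise from some hidden tree, some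
pair of vertices is at maximum distance in all the trees consistent with these answers. -/
def FindsMaxDistPair {V : Type*} (Q : SimpleGraph V) : Prop :=
  ∀ q : Sym2 V → ℕ, (∃ T, IsConsistent Q q T) →
    ∃ x y : V, ∀ T, IsConsistent Q q T → IsMaxDistPair T x y

/-- `Q` determines the hidden tree up to isomorphism: whatever the answers, all the trees consistent
with them are isomorphic. -/
def DeterminesUpToIso {V : Type*} (Q : SimpleGraph V) : Prop :=
  ∀ q : Sym2 V → ℕ, ∀ T T' : SimpleGraph V,
    IsConsistent Q q T → IsConsistent Q q T' → Nonempty (T ≃g T')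

/-- The least number of edges of a query graph on `n` vertices that finds two vertices at maximum
distance in the hidden tree. -/
noncomputable def fN (n : ℕ) : ℕ :=
  sInf {m | ∃ Q : SimpleGraph (Fin n), FindsMaxDistPair Q ∧ Q.edgeSet.ncard = m}

/-- The least number of edges of a query graph on `n` vertices that determines the hidden tree up to
isomorphism. -/
noncomputable def hN (n : ℕ) : ℕ :=
  sInf {m | ∃ Q : SimpleGraph (Fin n), DeterminesUpToIso Q ∧ Q.edgeSet.ncard = m}

/-! Sufficiency. If all degrees are at least n-3, each vertex misses at most two queries, so the
metrics `d`, `d'` of two consistent trees agree off a relation `N` of maximum degree two. Suppose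
`d' u v < d u v`. By the four-point condition, all vertices queried with both `u` and `v` hang from
one point of the `u`-`v` path of the first tree (`class_eq`). Its inner vertices lie at different
points, so all but at most one of them are unqueried with `u` or `v`, and there is room for only two
such vertices. Hence `d u v ≤ 4` (`le_four`), and parity leaves only the drops 4 to 2 and 3 to 1. An
edge of only one of the trees therefore comes from a vertex moving between two neighbours of a
common centre (`exists_moves`). These moves interact so little that permuting vertices around each
centre gives an isomorphism (`nonempty_iso`). So all consistent trees have the same diameter. A
queried diametral pair keeps its distance; if none was queried, no diametral pair can come closer
(`not_lt_of_forall_le`).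

Necessity. If `v` misses queries to `a`, `b`, `c`, two spiders with different diameters give the
same answers, and no pair is diametral in both. The edge count then follows from the handshake lemma
and the complement of a cycle. -/

/-! ### Metric properties of trees: four-point condition, parity, geodesics. -/

section TreeMetric

variable {V : Type*}

/-- The properties of the distance function of a tree that are used below. -/
structure IsTreeMetric (d : V → V → ℕ) : Prop where
  eq_zero : ∀ x y, d x y = 0 ↔ x = y
  symm : ∀ x y, d x y = d y x
  triangle : ∀ x y z, d x z ≤ d x y + d y z
  even : ∀ x y z, (d x y + d y z + d x z) % 2 = 0
  fourPoint : ∀ x y z w,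
    (d x y + d z w ≤ d x z + d y w ∧ d x z + d y w = d x w + d y z) ∨
    (d x z + d y w ≤ d x y + d z w ∧ d x y + d z w = d x w + d y z) ∨
    (d x w + d y z ≤ d x y + d z w ∧ d x y + d z w = d x z + d y w)
  between : ∀ x y k, k ≤ d x y → ∃ z, d x z = k ∧ d z y = d x y - k

namespace SimpleGraph

theorem Connected.exists_adj_dist_add_one {T : SimpleGraph V} (hT : T.Connected) {x y : V}
    (hxy : x ≠ y) : ∃ z, T.Adj x z ∧ T.dist z y + 1 = T.dist x y := by
  obtain ⟨p, hp⟩ := hT.exists_walk_length_eq_dist x y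
  cases p with
  | nil => exact absurd rfl hxy
  | cons h p =>
    rename_i z
    refine ⟨z, h, ?_⟩
    have h1 := dist_le p
    have h2 := hT.dist_triangle (u := x) (v := z) (w := y)
    have h3 := dist_eq_one_iff_adj.2 h
    simp only [Walk.length_cons] at hp
    omega

theorem IsTree.eq_of_adj_of_dist_add_one {T : SimpleGraph V} (hT : T.IsTree) {x y a b : V}
    (ha : T.Adj a y) (hb : T.Adj b y) (hda : T.dist x a + 1 = T.dist x y)
    (hdb : T.dist x b + 1 = T.dist x y) : a = b := by
  obtain ⟨p, hp⟩ := hT.connected.exists_walk_length_eq_dist x a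
  obtain ⟨q, hq⟩ := hT.connected.exists_walk_length_eq_dist x b
  have hp' : (p.concat ha).IsPath := Walk.isPath_of_length_eq_dist _ (by simp; omega)
  have hq' : (q.concat hb).IsPath := Walk.isPath_of_length_eq_dist _ (by simp; omega)
  have h := congrArg Subtype.val ((hT.isAcyclic.subsingleton_path x y).elim ⟨_, hp'⟩ ⟨_, hq'⟩)
  have h2 := congrArg Walk.penultimate h
  simpa using h2

/-- Follow a geodesic from `x` to `z`. After stepping away from `y` to `b`, a step back towards `y`
could only return to `x`, the unique neighbour of `b` nearer to `y`. -/
theorem IsTree.dist_add_dist_of_ne {T : SimpleGraph V} (hT : T.IsTree) (y z : V) {x b : V}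
    (hb : T.Adj x b) (hbz : T.dist b z + 1 = T.dist x z) (hby : T.dist y b = T.dist y x + 1) :
    T.dist y z = T.dist y x + T.dist x z := by
  obtain ⟨k, hk⟩ : ∃ k, T.dist x z = k := ⟨_, rfl⟩
  induction k generalizing x b with
  | zero => omega
  | succ k ih =>
    by_cases hbz' : b = z
    · subst hbz'
      have := dist_eq_one_iff_adj.2 hb
      omega
    · obtain ⟨c, hc, hcz⟩ := hT.connected.exists_adj_dist_add_one hbz'
      have hcy : T.dist y c = T.dist y b + 1 := by
        rcases hT.dist_eq_dist_add_one_of_adj y hc with h | h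
        · have : x = c := hT.eq_of_adj_of_dist_add_one (x := y) hb hc.symm (by omega) (by omega)
          subst this
          omega
        · omega
      have := ih hc hcz hcy (by omega)
      omega

/-- Induction on `T.dist x y`, replacing `x` by its neighbour `a` towards `y`. For each of `z`, `w`,
either this step approaches it too or `x` lies between it and `y` (`key`). If both are approached,
all three sums drop by one; otherwise the sums are computed through `x`. -/
theorem IsTree.dist_fourPoint {T : SimpleGraph V} (hT : T.IsTree) (x y z w : V) :
    (T.dist x y + T.dist z w ≤ T.dist x z + T.dist y w ∧
      T.dist x z + T.dist y w = T.dist x w + T.dist y z) ∨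
    (T.dist x z + T.dist y w ≤ T.dist x y + T.dist z w ∧
      T.dist x y + T.dist z w = T.dist x w + T.dist y z) ∨
    (T.dist x w + T.dist y z ≤ T.dist x y + T.dist z w ∧
      T.dist x y + T.dist z w = T.dist x z + T.dist y w) := by
  obtain ⟨k, hk⟩ : ∃ k, T.dist x y = k := ⟨_, rfl⟩
  have hc := hT.connected
  have htri : ∀ a b c, T.dist a c ≤ T.dist a b + T.dist b c := fun a b c => hc.dist_triangle
  have hsymm : ∀ a b, T.dist a b = T.dist b a := fun a b => dist_comm
  induction k generalizing x with
  | zero =>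
    have : x = y := hc.dist_eq_zero_iff.1 hk
    subst this
    have := htri z x w
    have := hsymm z x
    omega
  | succ k ih =>
    by_cases hxz : x = z
    · subst hxz
      have h0 : T.dist x x = 0 := dist_self
      have := htri y x w
      have := hsymm y x
      omega
    by_cases hxw : x = w
    · subst hxw
      have h0 : T.dist x x = 0 := dist_self
      have := htri y x z
      have := hsymm y x
      have := hsymm z x
      omega
    have hxy : x ≠ y := by
      rintro rfl
      rw [dist_self] at hk
      omega
    obtain ⟨a, ha, hay⟩ := hc.exists_adj_dist_add_one hxy
    have key : ∀ t, x ≠ t → T.dist a t + 1 = T.dist x t ∨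
        T.dist y t = T.dist y x + T.dist x t := by
      intro t ht
      obtain ⟨b, hb, hbt⟩ := hc.exists_adj_dist_add_one ht
      by_cases hab : a = b
      · subst hab
        exact Or.inl hbt
      · right
        refine hT.dist_add_dist_of_ne y t hb hbt ?_
        rcases hT.dist_eq_dist_add_one_of_adj y hb with h | h
        · refine absurd (hT.eq_of_adj_of_dist_add_one (x := y) ha.symm hb.symm ?_ ?_) hab
          · rw [hsymm y a, hsymm y x, hay]
          · omega
        · omega
    have hzw : T.dist a z + 1 = T.dist x z → T.dist y w = T.dist y x + T.dist x w →
        T.dist z w = T.dist z x + T.dist x w := by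
      intro h1 h2
      obtain ⟨b, hb, hbt⟩ := hc.exists_adj_dist_add_one hxw
      refine hT.dist_add_dist_of_ne z w hb hbt ?_
      rcases hT.dist_eq_dist_add_one_of_adj z hb with h | h
      · have hab : a = b := by
          refine hT.eq_of_adj_of_dist_add_one (x := z) ha.symm hb.symm ?_ ?_
          · rw [hsymm z a, hsymm z x, h1]
          · omega
        subst hab
        have := htri y a w
        have := hsymm y a
        have := hsymm y x
        omega
      · omega
    have hwz : T.dist a w + 1 = T.dist x w → T.dist y z = T.dist y x + T.dist x z →
        T.dist z w = T.dist z x + T.dist x w := by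
      intro h1 h2
      obtain ⟨b, hb, hbt⟩ := hc.exists_adj_dist_add_one hxz
      have := hT.dist_add_dist_of_ne w z hb hbt ?_
      · rw [hsymm z w, this, hsymm w x, hsymm x z]
        omega
      rcases hT.dist_eq_dist_add_one_of_adj w hb with h | h
      · have hab : a = b := by
          refine hT.eq_of_adj_of_dist_add_one (x := w) ha.symm hb.symm ?_ ?_
          · rw [hsymm w a, hsymm w x, h1]
          · omega
        subst hab
        have := htri y a z
        have := hsymm y a
        have := hsymm y x
        omega
      · omega
    have e1 := hsymm y x
    have e2 := hsymm z x
    have t1 := htri z x w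
    have t2 := htri y x z
    have t3 := htri y x w
    rcases key z hxz with h1 | h1 <;> rcases key w hxw with h2 | h2
    · have := ih a (by omega)
      omega
    · have := hzw h1 h2
      omega
    · have := hwz h2 h1
      omega
    · omega

theorem IsTree.even_dist {T : SimpleGraph V} (hT : T.IsTree) (x y z : V) :
    (T.dist x y + T.dist y z + T.dist x z) % 2 = 0 := by
  obtain ⟨k, hk⟩ : ∃ k, T.dist y z = k := ⟨_, rfl⟩
  induction k generalizing y with
  | zero =>
    have : y = z := hT.connected.dist_eq_zero_iff.1 hk
    subst this
    omega
  | succ k ih =>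
    have hyz : y ≠ z := by
      rintro rfl
      rw [dist_self] at hk
      omega
    obtain ⟨a, ha, hay⟩ := hT.connected.exists_adj_dist_add_one hyz
    have := ih a (by omega)
    rcases hT.dist_eq_dist_add_one_of_adj x ha with h | h <;> omega

theorem Connected.exists_dist_eq_sub {T : SimpleGraph V} (hT : T.Connected) (x y : V) (k : ℕ)
    (hk : k ≤ T.dist x y) : ∃ z, T.dist x z = k ∧ T.dist z y = T.dist x y - k := by
  induction k with
  | zero => exact ⟨x, dist_self, by simp⟩
  | succ k ih =>
    obtain ⟨z, hz, hzy⟩ := ih (by omega)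
    have hne : z ≠ y := by
      rintro rfl
      rw [dist_self] at hzy
      omega
    obtain ⟨a, ha, hay⟩ := hT.exists_adj_dist_add_one hne
    have h1 := hT.dist_triangle (u := x) (v := z) (w := a)
    have h2 := hT.dist_triangle (u := x) (v := a) (w := y)
    have h3 := dist_eq_one_iff_adj.2 ha
    exact ⟨a, by omega, by omega⟩

theorem IsTree.isTreeMetric_dist {T : SimpleGraph V} (hT : T.IsTree) : IsTreeMetric T.dist where
  eq_zero _ _ := hT.connected.dist_eq_zero_iff
  symm _ _ := dist_comm
  triangle _ _ _ := hT.connected.dist_triangle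
  even := hT.even_dist
  fourPoint := hT.dist_fourPoint
  between := hT.connected.exists_dist_eq_sub

end SimpleGraph

end TreeMetric

/-! ### How two nearly equal tree metrics can differ. -/

section NearlyEqual

variable {V : Type*}

/-- Two tree metrics on a large set that agree on all pairs outside a symmetric relation `N` of
maximum degree at most two. -/
structure NearlyEqual (N : V → V → Prop) (d d' : V → V → ℕ) : Prop where
  left : IsTreeMetric d
  right : IsTreeMetric d'
  symm : ∀ x y, N x y → N y x
  agree : ∀ x y, ¬ N x y → d x y = d' x y
  few : ∀ v a b c, N v a → N v b → N v c → a = b ∨ a = c ∨ b = c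
  large : ∀ s : Finset V, s.card ≤ 12 → ∃ z, z ∉ s

namespace NearlyEqual

variable {N : V → V → Prop} {d d' : V → V → ℕ}

theorem swap (h : NearlyEqual N d d') : NearlyEqual N d' d :=
  ⟨h.right, h.left, h.symm, fun x y hxy => (h.agree x y hxy).symm, h.few, h.large⟩

theorem exists_cover (h : NearlyEqual N d d') (v : V) : ∃ a b, ∀ t, N v t → t = a ∨ t = b := by
  by_cases h1 : ∃ a, N v a
  · obtain ⟨a, ha⟩ := h1
    by_cases h2 : ∃ b, N v b ∧ b ≠ a
    · obtain ⟨b, hb, hba⟩ := h2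
      refine ⟨a, b, fun t ht => ?_⟩
      rcases h.few v a b t ha hb ht with e | e | e
      · exact absurd e.symm hba
      · exact Or.inl e.symm
      · exact Or.inr e.symm
    · push Not at h2
      exact ⟨a, a, fun t ht => Or.inl (h2 t ht)⟩
  · push Not at h1
    exact ⟨v, v, fun t ht => absurd ht (h1 t)⟩

/-- Four vertices exclude at most eight others; with `x` and `y` this makes ten. -/
theorem exists_avoiding (h : NearlyEqual N d d') (a b c e x y : V) :
    ∃ t, ¬ N a t ∧ ¬ N b t ∧ ¬ N c t ∧ ¬ N e t ∧ t ≠ x ∧ t ≠ y := by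
  classical
  choose f g hfg using h.exists_cover
  obtain ⟨t, ht⟩ := h.large [f a, g a, f b, g b, f c, g c, f e, g e, x, y].toFinset
    ((List.toFinset_card_le _).trans (by simp))
  simp only [List.mem_toFinset, List.mem_cons, List.not_mem_nil, or_false, not_or] at ht
  obtain ⟨h1, h2, h3, h4, h5, h6, h7, h8, h9, h10⟩ := ht
  refine ⟨t, fun k => ?_, fun k => ?_, fun k => ?_, fun k => ?_, h9, h10⟩ <;>
    rcases hfg _ _ k with e | e <;> contradiction

/-- Since `N u v` uses one slot of each end, each has room for only one more vertex. -/
theorem not_three (h : NearlyEqual N d d') {u v a b c : V} (huv : N u v)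
    (ha : N u a ∨ N v a) (hb : N u b ∨ N v b) (hc : N u c ∨ N v c)
    (hab : a ≠ b) (hac : a ≠ c) (hbc : b ≠ c) (hau : a ≠ u) (hbu : b ≠ u) (hcu : c ≠ u)
    (hav : a ≠ v) (hbv : b ≠ v) (hcv : c ≠ v) : False := by
  have hvu := h.symm _ _ huv
  have k1 := h.few u v
  have k2 := h.few v u
  grind

theorem mod_two_eq (h : NearlyEqual N d d') (x y : V) : d x y % 2 = d' x y % 2 := by
  obtain ⟨t, h1, h2, -⟩ := h.exists_avoiding x y x x x x
  have e1 := h.left.even x y t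
  have e2 := h.right.even x y t
  have := h.agree _ _ h1
  have := h.agree _ _ h2
  omega

/-- When the two mixed sums differ, the four-point condition makes `d u v + d a b` equal to the
larger one. If `a b` also agreed, this would hold in both metrics and force `d u v = d' u v`. -/
theorem ne_of_class_ne (h : NearlyEqual N d d') {u v a b : V} (hlt : d' u v < d u v)
    (hua : ¬ N u a) (hva : ¬ N v a) (hub : ¬ N u b) (hvb : ¬ N v b)
    (hne : d u a + d v b ≠ d u b + d v a) : N a b := by
  by_contra hab
  have e1 := h.left.fourPoint u v a b
  have e2 := h.right.fourPoint u v a b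
  have := h.agree _ _ hua
  have := h.agree _ _ hub
  have := h.agree _ _ hva
  have := h.agree _ _ hvb
  have := h.agree _ _ hab
  omega

theorem class_eq (h : NearlyEqual N d d') {u v a b : V} (hlt : d' u v < d u v)
    (hua : ¬ N u a) (hva : ¬ N v a) (hub : ¬ N u b) (hvb : ¬ N v b) :
    d u a + d v b = d u b + d v a := by
  obtain ⟨t, hut, hvt, hat, hbt, -⟩ := h.exists_avoiding u v a b u u
  by_contra hne
  have h1 : d u a + d v t = d u t + d v a := by
    by_contra k
    exact hat (h.ne_of_class_ne hlt hua hva hut hvt k)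
  have h2 : d u b + d v t = d u t + d v b := by
    by_contra k
    exact hbt (h.ne_of_class_ne hlt hub hvb hut hvt k)
  omega

theorem rel_of_lt (h : NearlyEqual N d d') {u v : V} (hlt : d' u v < d u v) : N u v := by
  by_contra hne
  have := h.agree _ _ hne
  omega

theorem interior (h : NearlyEqual N d d') {u v a b : V} (hlt : d' u v < d u v)
    (ha : d u a + d a v = d u v) (hb : d u b + d b v = d u v) (hab : d u a ≠ d u b) :
    (N u a ∨ N v a) ∨ (N u b ∨ N v b) := by
  by_contra k
  push Not at k
  have := h.class_eq hlt k.1.1 k.1.2 k.2.1 k.2.2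
  have := h.left.symm v a
  have := h.left.symm v b
  omega

theorem not_three_interior (h : NearlyEqual N d d') {u v a b c : V} (hlt : d' u v < d u v)
    (ha : N u a ∨ N v a) (hb : N u b ∨ N v b) (hc : N u c ∨ N v c)
    (hab : d u a ≠ d u b) (hac : d u a ≠ d u c) (hbc : d u b ≠ d u c)
    (ha0 : d u a ≠ 0) (hb0 : d u b ≠ 0) (hc0 : d u c ≠ 0)
    (ha1 : d a v ≠ 0) (hb1 : d b v ≠ 0) (hc1 : d c v ≠ 0) : False := by
  have e := h.left.eq_zero
  refine h.not_three (h.rel_of_lt hlt) ha hb hc ?_ ?_ ?_ ?_ ?_ ?_ ?_ ?_ ?_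
  · rintro rfl; exact hab rfl
  · rintro rfl; exact hac rfl
  · rintro rfl; exact hbc rfl
  · rintro rfl; exact ha0 ((e _ _).2 rfl)
  · rintro rfl; exact hb0 ((e _ _).2 rfl)
  · rintro rfl; exact hc0 ((e _ _).2 rfl)
  · rintro rfl; exact ha1 ((e _ _).2 rfl)
  · rintro rfl; exact hb1 ((e _ _).2 rfl)
  · rintro rfl; exact hc1 ((e _ _).2 rfl)

/-- Otherwise there are four inner vertices; at most one is queried with both ends, and three others
contradict `not_three`. -/
theorem le_four (h : NearlyEqual N d d') {u v : V} (hlt : d' u v < d u v) : d u v ≤ 4 := by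
  by_contra hD
  push Not at hD
  obtain ⟨a, ha, ha'⟩ := h.left.between u v 1 (by omega)
  obtain ⟨b, hb, hb'⟩ := h.left.between u v 2 (by omega)
  obtain ⟨c, hc, hc'⟩ := h.left.between u v 3 (by omega)
  obtain ⟨e, he, he'⟩ := h.left.between u v 4 (by omega)
  have hab := h.interior hlt (a := a) (b := b) (by omega) (by omega) (by omega)
  have hac := h.interior hlt (a := a) (b := c) (by omega) (by omega) (by omega)
  have hae := h.interior hlt (a := a) (b := e) (by omega) (by omega) (by omega)
  have hbc := h.interior hlt (a := b) (b := c) (by omega) (by omega) (by omega)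
  have hbe := h.interior hlt (a := b) (b := e) (by omega) (by omega) (by omega)
  have hce := h.interior hlt (a := c) (b := e) (by omega) (by omega) (by omega)
  have k1 : (N u a ∨ N v a) → (N u b ∨ N v b) → (N u c ∨ N v c) → False := fun x y z =>
    h.not_three_interior hlt x y z (by omega) (by omega) (by omega) (by omega) (by omega)
      (by omega) (by omega) (by omega) (by omega)
  have k2 : (N u a ∨ N v a) → (N u b ∨ N v b) → (N u e ∨ N v e) → False := fun x y z =>
    h.not_three_interior hlt x y z (by omega) (by omega) (by omega) (by omega) (by omega)
      (by omega) (by omega) (by omega) (by omega)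
  have k3 : (N u a ∨ N v a) → (N u c ∨ N v c) → (N u e ∨ N v e) → False := fun x y z =>
    h.not_three_interior hlt x y z (by omega) (by omega) (by omega) (by omega) (by omega)
      (by omega) (by omega) (by omega) (by omega)
  have k4 : (N u b ∨ N v b) → (N u c ∨ N v c) → (N u e ∨ N v e) → False := fun x y z =>
    h.not_three_interior hlt x y z (by omega) (by omega) (by omega) (by omega) (by omega)
      (by omega) (by omega) (by omega) (by omega)
  generalize (N u a ∨ N v a) = A at *
  generalize (N u b ∨ N v b) = B at *
  generalize (N u c ∨ N v c) = C at *
  generalize (N u e ∨ N v e) = E at *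
  clear * - hab hac hae hbc hbe hce k1 k2 k3 k4
  tauto

theorem pos_right (h : NearlyEqual N d d') {u v : V} (hlt : d' u v < d u v) : 1 ≤ d' u v := by
  by_contra k
  have h0 : d' u v = 0 := by omega
  have : u = v := (h.right.eq_zero _ _).1 h0
  subst this
  have := (h.left.eq_zero u u).2 rfl
  omega

/-- If a pair at distance four changes, the other vertices do not hang from its midpoint. -/
theorem class_ne_of_four (h : NearlyEqual N d d') {u v z : V} (hlt : d' u v < d u v)
    (h4 : d u v = 4) (hu : ¬ N u z) (hv : ¬ N v z) : d u z ≠ d v z := by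
  intro hz
  have hN := h.rel_of_lt hlt
  have hp := h.pos_right hlt
  have hm := h.mod_two_eq u v
  have h2 : d' u v = 2 := by omega
  obtain ⟨a, ha, ha'⟩ := h.left.between u v 1 (by omega)
  obtain ⟨b, hb, hb'⟩ := h.left.between u v 3 (by omega)
  obtain ⟨x, hx, hx'⟩ := h.right.between u v 1 (by omega)
  have sva := h.left.symm v a
  have svb := h.left.symm v b
  have svx' := h.right.symm v x
  have svx := h.left.symm v x
  have good : ∀ t, ¬ N u t → ¬ N v t → d u t = d v t := by
    intro t h1 h2
    have := h.class_eq hlt h1 h2 hu hv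
    omega
  have hna : N u a ∨ N v a := by
    by_contra k
    push Not at k
    have := good a k.1 k.2
    omega
  have hnb : N u b ∨ N v b := by
    by_contra k
    push Not at k
    have := good b k.1 k.2
    omega
  have hnx : N u x ∨ N v x := by
    by_contra k
    push Not at k
    have := h.agree _ _ k.1
    have := h.agree _ _ k.2
    have := h.left.triangle u x v
    omega
  have ne_u : ∀ t, d u t ≠ 0 → t ≠ u := by
    rintro t ht rfl
    exact ht ((h.left.eq_zero _ _).2 rfl)
  have ne_v : ∀ t, d t v ≠ 0 → t ≠ v := by
    rintro t ht rfl
    exact ht ((h.left.eq_zero _ _).2 rfl)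
  have hab : a ≠ b := by
    rintro rfl
    omega
  have hxu : x ≠ u := by
    rintro rfl
    have := (h.right.eq_zero x x).2 rfl
    omega
  have hxv : x ≠ v := by
    rintro rfl
    have := (h.right.eq_zero x x).2 rfl
    omega
  have hxab : x = a ∨ x = b := by
    by_contra k
    push Not at k
    exact h.not_three hN hna hnb hnx hab k.1.symm k.2.symm (ne_u a (by omega)) (ne_u b (by omega))
      hxu (ne_v a (by omega)) (ne_v b (by omega)) hxv
  -- Up to symmetry the new midpoint is `a`. Then `a v` has changed, so `N v a`, and `v b` is
  -- unchanged. In the second tree both `a` and `b` would be the neighbour of `v` towards `t`.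
  have main : ∀ u v a b, N u v → d u v = 4 → d' u v = 2 → d u a = 1 → d a v = 3 → d u b = 3 →
      d b v = 1 → d' u a = 1 → d' a v = 1 → (N u b ∨ N v b) →
      (∀ t, ¬ N u t → ¬ N v t → d u t = d v t) → False := by
    intro u v a b hN h4 h2 h1 h3 h5 h6 h7 h8 hnb good
    have hva : N v a := by
      by_contra k
      have := h.agree _ _ k
      have := h.left.symm v a
      have := h.right.symm v a
      omega
    have nev : ¬ N v b := by
      intro k
      rcases h.few v a b u hva k (h.symm _ _ hN) with e | e | e
      · subst e; omega
      · subst e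
        have := (h.left.eq_zero a a).2 rfl
        omega
      · subst e
        have := (h.left.eq_zero b b).2 rfl
        omega
    have hvb := h.agree _ _ nev
    obtain ⟨t, t1, t2, t3, -⟩ := h.exists_avoiding u v b b u u
    have := good t t1 t2
    have := h.agree _ _ t1
    have := h.agree _ _ t2
    have := h.agree _ _ t3
    have := h.left.fourPoint u v b t
    have := h.right.fourPoint u v b t
    have := h.right.fourPoint u v a b
    have hab : d' a b ≠ 0 := by
      intro k
      have := (h.right.eq_zero _ _).1 k
      subst this
      omega
    have := h.left.symm v b
    have := h.right.symm v a
    have := h.right.triangle u v b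
    have := h.right.even u v b
    have : d' u b ≠ 0 := by
      intro k
      have := (h.right.eq_zero _ _).1 k
      subst this
      have := (h.left.eq_zero u u).2 rfl
      omega
    omega
  rcases hxab with e | e
  · subst e
    exact main u v x b hN h4 h2 ha (by omega) hb (by omega) hx (by omega) hnb good
  · subst e
    have huv := h.left.symm u v
    have huv' := h.right.symm u v
    have := h.left.symm u a
    have := h.left.symm u x
    have := h.right.symm u x
    exact main v u x a (h.symm _ _ hN) (by omega) (by omega) (by omega) (by omega) (by omega)
      (by omega) (by omega) (by omega) hna.symm (fun t h1 h2 => (good t h2 h1).symm)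

/-- If the distance of `u` and `v` drops from three to one, then `v` moves from `q` to `u`, both of
them neighbours of `p`. -/
theorem exists_of_three (h : NearlyEqual N d d') {u v : V} (h3 : d u v = 3) (h1 : d' u v = 1)
    (hpos : ∀ t, ¬ N u t → ¬ N v t → d u t + 1 = d v t) :
    ∃ p q, N v u ∧ N v q ∧ d v q = 1 ∧ d' v q = 3 ∧ d p u = 1 ∧ d p q = 1 ∧ d' p u = 1 ∧
      d' p q = 1 := by
  have hlt : d' u v < d u v := by omega
  have hN := h.rel_of_lt hlt
  have hN' := h.symm _ _ hN
  obtain ⟨p, hup, hpv⟩ := h.left.between u v 1 (by omega)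
  obtain ⟨q, hpq, hqv⟩ := h.left.between p v 1 (by omega)
  have := h.left.triangle u p q
  have := h.left.triangle u q v
  have huq : d u q = 2 := by omega
  have svq := h.left.symm v q
  have svp := h.left.symm v p
  have spu := h.left.symm p u
  have svq' := h.right.symm v q
  have svp' := h.right.symm v p
  have spu' := h.right.symm p u
  have suv' := h.right.symm u v
  have spq' := h.right.symm p q
  have hne : ∀ x y, d x y ≠ 0 → x ≠ y := by
    rintro x y ht rfl
    exact ht ((h.left.eq_zero _ _).2 rfl)
  have hne' : ∀ x y, x ≠ y → d' x y ≠ 0 := fun x y hxy k => hxy ((h.right.eq_zero _ _).1 k)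
  have hqu : u ≠ q := hne _ _ (by omega)
  have hqv' : q ≠ v := hne _ _ (by omega)
  have hpu : p ≠ u := hne _ _ (by omega)
  have hpv' : p ≠ v := hne _ _ (by omega)
  have hpq' : p ≠ q := hne _ _ (by omega)
  have huv : u ≠ v := hne _ _ (by omega)
  have hnq : N u q ∨ N v q := by
    by_contra k
    push Not at k
    have := hpos q k.1 k.2
    omega
  -- All distances from `z` to the path are unchanged, and `z` hangs from `p`; the four-point
  -- condition with `z` pins down the second tree.
  obtain ⟨z, z1, z2, z3, z4, z5, -⟩ := h.exists_avoiding u v p q p p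
  have hz := hpos z z1 z2
  have a1 := h.agree _ _ z1
  have a2 := h.agree _ _ z2
  have a3 := h.agree _ _ z3
  have a4 := h.agree _ _ z4
  have hzq : d q z = d u z := by
    have := h.left.fourPoint u v q z
    omega
  have hzp : d p z + 1 = d u z := by
    have := h.left.fourPoint u v p z
    have := h.left.triangle u p z
    omega
  have evenuq : d' u q % 2 = 0 := by
    have := h.mod_two_eq u q
    omega
  have hvq : N v q := by
    by_contra k
    have := h.agree _ _ k
    have := h.right.triangle u v q
    have := hne' u q hqu
    have := h.right.fourPoint u v q z
    omega
  have hqv2 := h.symm _ _ hvq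
  have hnp : ¬ N v p := fun k => by
    rcases h.few v u q p hN' hvq k with e | e | e
    · exact hqu e
    · exact hpu e.symm
    · exact hpq' e.symm
  have ap := h.agree _ _ hnp
  have huq' : d' u q = 2 := by
    by_cases k : N u q
    · have n1 : ¬ N u p := fun k' => by
        rcases h.few u v q p hN k k' with e | e | e
        · exact hqv' e.symm
        · exact hpv' e.symm
        · exact hpq' e.symm
      have n2 : ¬ N q p := fun k' => by
        rcases h.few q v u p hqv2 (h.symm _ _ k) k' with e | e | e
        · exact huv e.symm
        · exact hpv' e.symm
        · exact hpu e.symm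
      have := h.agree _ _ n1
      have := h.agree _ _ n2
      have := h.right.triangle u p q
      have := hne' u q hqu
      have := h.left.symm q p
      have := h.right.symm q p
      omega
    · have := h.agree _ _ k
      omega
  have hz0 : d p z ≠ 0 := fun k => z5 ((h.left.eq_zero _ _).1 k).symm
  have hup' : d' u p = 1 := by
    have := h.right.fourPoint u v p z
    have := hne' p u hpu
    omega
  have hpq'' : d' p q = 1 := by
    have := h.right.fourPoint u q p z
    have := h.right.symm q p
    have := hne' p q hpq'
    omega
  have hvq' : d' v q = 3 := by
    have := h.right.fourPoint u q v z
    omega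
  exact ⟨p, q, hN', hvq, by omega, hvq', by omega, hpq, by omega, hpq''⟩

/-- `v` is attached to `q` in the first tree and to `u` in the second one, and otherwise `q` and `u`
are neighbours of `p` in both trees. -/
def Moves (N : V → V → Prop) (d d' : V → V → ℕ) (v q u p : V) : Prop :=
  N v u ∧ N v q ∧ d v q = 1 ∧ d' v q = 3 ∧ d' v u = 1 ∧ d v u = 3 ∧
    d p u = 1 ∧ d p q = 1 ∧ d' p u = 1 ∧ d' p q = 1

theorem Moves.swap {v q u p : V} (hm : Moves N d d' v q u p) : Moves N d' d v u q p := by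
  obtain ⟨h1, h2, h3, h4, h5, h6, h7, h8, h9, h10⟩ := hm
  exact ⟨h2, h1, h5, h6, h3, h4, h10, h9, h8, h7⟩

/-- By `le_four` and parity the old distance is 3. Which inner vertex of the old path carries the
remaining vertices decides which end moved. -/
theorem exists_moves (h : NearlyEqual N d d') {u v : V} (hne : d u v ≠ 1) (h1 : d' u v = 1) :
    (∃ q p, Moves N d d' v q u p) ∨ ∃ q p, Moves N d d' u q v p := by
  have h0 : d u v ≠ 0 := by
    intro k
    have := (h.left.eq_zero _ _).1 k
    subst this
    have := (h.right.eq_zero u u).2 rfl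
    omega
  have hlt : d' u v < d u v := by omega
  have h4 := h.le_four hlt
  have hm := h.mod_two_eq u v
  have h3 : d u v = 3 := by omega
  have s := h.left.symm u v
  have s' := h.right.symm u v
  obtain ⟨t, t1, t2, -⟩ := h.exists_avoiding u v u u u u
  have b1 := h.agree _ _ t1
  have b2 := h.agree _ _ t2
  have c1 := h.right.triangle u v t
  have c2 := h.right.triangle v u t
  have c3 := h.left.even u v t
  by_cases ht : d u t + 1 = d v t
  · left
    obtain ⟨p, q, e1, e2, e3, e4, e5, e6, e7, e8⟩ := h.exists_of_three h3 h1 (fun x x1 x2 => by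
      have := h.class_eq hlt x1 x2 t1 t2
      omega)
    exact ⟨q, p, e1, e2, e3, e4, by omega, by omega, e5, e6, e7, e8⟩
  · right
    have ht' : d v t + 1 = d u t := by omega
    obtain ⟨p, q, e1, e2, e3, e4, e5, e6, e7, e8⟩ := h.exists_of_three (u := v) (v := u)
      (by omega) (by omega) (fun x x1 x2 => by
      have := h.class_eq hlt x2 x1 t1 t2
      omega)
    exact ⟨q, p, e1, e2, e3, e4, by omega, by omega, e5, e6, e7, e8⟩

end NearlyEqual

end NearlyEqual

/-! ### Combining the moves into an isomorphism. -/

section Iso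

variable {V : Type*}

namespace NearlyEqual

variable {N : V → V → Prop} {d d' : V → V → ℕ}

theorem Moves.source_ne_target {v q u p : V}
    (hm : Moves N d d' v q u p) : q ≠ u := by
  rintro rfl
  obtain ⟨-, -, h3, -, -, h6, -⟩ := hm
  omega

/-- Another common neighbour `x` of `q` would be at distance 2 from `v` in the first tree and 4 in
the second, but the slots of `v` are taken by `u` and `q`. -/
theorem Moves.eq_center (h : NearlyEqual N d d') {v q u p x : V} (hm : Moves N d d' v q u p)
    (hx : d q x = 1) (hx' : d' q x = 1) : x = p := by
  obtain ⟨h1, h2, h3, h4, h5, h6, h7, h8, h9, h10⟩ := hm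
  by_contra hne
  have hpx : d' p x ≠ 0 := fun k => hne ((h.right.eq_zero _ _).1 k).symm
  have hvx : d v x ≠ 0 := fun k => by
    have := (h.left.eq_zero _ _).1 k
    subst this
    have := h.right.symm q v
    omega
  have := h.right.symm q p
  have := h.right.symm u p
  have := h.right.triangle v u p
  have := h.right.triangle v p q
  have := h.right.triangle p q x
  have := h.right.even p q x
  have := h.left.triangle v q x
  have := h.left.even v q x
  have := h.right.fourPoint v p q x
  have hN : N v x := by
    by_contra k
    have := h.agree _ _ k
    omega
  rcases h.few v u q x h1 h2 hN with e | e | e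
  · subst e
    omega
  · subst e
    have := h.left.even p q u
    omega
  · subst e
    have := (h.left.eq_zero q q).2 rfl
    omega

/-- Distinct movers `v`, `v₂` leaving `q` are at distance 2, and this pair was queried. In the
second tree both are at distance 3 from `q`, so they share their neighbour towards `q`. -/
theorem Moves.target_unique (h : NearlyEqual N d d') {v q u p v₂ u₂ p₂ : V}
    (hm : Moves N d d' v q u p) (hm₂ : Moves N d d' v₂ q u₂ p₂) : u = u₂ := by
  obtain ⟨h1, h2, h3, h4, h5, h6, h7, h8, h9, h10⟩ := hm
  obtain ⟨k1, k2, k3, k4, k5, k6, k7, k8, k9, k10⟩ := hm₂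
  by_cases hvv : v = v₂
  · subst hvv
    rcases h.few v u q u₂ h1 h2 k1 with e | e | e
    · subst e; omega
    · exact e
    · subst e; omega
  · have hne : d v v₂ ≠ 0 := fun k => hvv ((h.left.eq_zero _ _).1 k)
    have := h.left.symm q v₂
    have := h.left.triangle v q v₂
    have := h.left.even v q v₂
    have hd : d v v₂ = 2 := by omega
    have hN : ¬ N v v₂ := by
      intro hN
      rcases h.few v u q v₂ h1 h2 hN with e | e | e
      · subst e; omega
      · subst e
        have := h.left.even p q u
        omega
      · subst e
        have := (h.left.eq_zero q q).2 rfl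
        omega
    have hd' := h.agree _ _ hN
    have := h.right.symm u p
    have := h.right.symm u₂ p₂
    have := h.right.symm u v
    have := h.right.symm u v₂
    have := h.right.symm u₂ v₂
    have := h.right.triangle u p q
    have := h.right.triangle v u q
    have := h.right.triangle u₂ p₂ q
    have := h.right.triangle v₂ u₂ q
    have := h.right.even v v₂ u
    have := h.right.fourPoint v v₂ u q
    have := h.right.fourPoint u u₂ v₂ q
    have h0 : d' v₂ u ≠ 0 := fun k => by
      have := (h.right.eq_zero _ _).1 k
      subst this
      omega
    exact (h.right.eq_zero _ _).1 (by omega)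

/-- The slots of `v` force `v₂ = q`. Then `p` and `u₂` are both the neighbour of `q` towards `v` in
the second tree, yet their distances from `q` in the first are 1 and 3. -/
theorem Moves.mover_not_source (h : NearlyEqual N d d') {v q u p v₂ u₂ p₂ : V}
    (hm : Moves N d d' v q u p) (hm₂ : Moves N d d' v₂ v u₂ p₂) : False := by
  obtain ⟨h1, h2, h3, h4, h5, h6, h7, h8, h9, h10⟩ := hm
  obtain ⟨k1, k2, k3, k4, k5, k6, k7, k8, k9, k10⟩ := hm₂
  have hs := h.left.symm v v₂
  rcases h.few v u q v₂ h1 h2 (h.symm _ _ k2) with e | e | e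
  · subst e; omega
  · subst e; omega
  · subst e
    have := h.right.symm v p₂
    have := h.right.symm q p
    have := h.right.symm q u₂
    have := h.right.symm u₂ p₂
    have := h.right.symm u p
    have := h.right.triangle v u p
    have := h.right.triangle v p q
    have := h.right.triangle v p₂ u₂
    have := h.right.triangle v u₂ q
    have := h.right.fourPoint v q p u₂
    have e0 := (h.right.eq_zero p u₂).1 (by omega)
    subst e0
    have := h.left.symm p q
    omega

theorem Moves.mover_not_target (h : NearlyEqual N d d') {v q u p v₂ q₂ p₂ : V}
    (hm : Moves N d d' v q u p) (hm₂ : Moves N d d' v₂ q₂ v p₂) : False :=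
  Moves.mover_not_source h.swap hm.swap hm₂.swap

/-- The centre has two common neighbours `q` and `u`; `eq_center` allows a source only one. -/
theorem Moves.center_not_source (h : NearlyEqual N d d') {v q u p v₂ u₂ p₂ : V}
    (hm : Moves N d d' v q u p) (hm₂ : Moves N d d' v₂ p u₂ p₂) : False := by
  have hne := hm.source_ne_target
  obtain ⟨h1, h2, h3, h4, h5, h6, h7, h8, h9, h10⟩ := hm
  exact hne ((hm₂.eq_center h h8 h10).trans (hm₂.eq_center h h7 h9).symm)

/-- `x` is the old or the new neighbour of some moving vertex, with centre `k`. -/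
def Centered (N : V → V → Prop) (d d' : V → V → ℕ) (x k : V) : Prop :=
  (∃ v u, Moves N d d' v x u k) ∨ ∃ v q, Moves N d d' v q x k

theorem Centered.swap {x k : V} (hx : Centered N d d' x k) : Centered N d' d x k := by
  rcases hx with ⟨v, u, hm⟩ | ⟨v, u, hm⟩
  · exact Or.inr ⟨v, u, hm.swap⟩
  · exact Or.inl ⟨v, u, hm.swap⟩

theorem Centered.eq_center (h : NearlyEqual N d d') {x k y : V} (hx : Centered N d d' x k)
    (hy : d x y = 1) (hy' : d' x y = 1) : y = k := by
  rcases hx with ⟨v, u, hm⟩ | ⟨v, u, hm⟩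
  · exact hm.eq_center h hy hy'
  · exact hm.swap.eq_center h.swap hy' hy

theorem Centered.dist_left {x k : V} (hx : Centered N d d' x k) : d k x = 1 := by
  rcases hx with ⟨v, u, hm⟩ | ⟨v, u, hm⟩
  · exact hm.2.2.2.2.2.2.2.1
  · exact hm.2.2.2.2.2.2.1

theorem Centered.dist_right {x k : V} (hx : Centered N d d' x k) : d' k x = 1 :=
  hx.swap.dist_left

theorem Centered.unique (h : NearlyEqual N d d') {x k k' : V} (hx : Centered N d d' x k)
    (hx' : Centered N d d' x k') : k' = k :=
  hx.eq_center h ((h.left.symm _ _).trans hx'.dist_left)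
    ((h.right.symm _ _).trans hx'.dist_right)

theorem Centered.center_not_centered (h : NearlyEqual N d d') {x k l : V}
    (hx : Centered N d d' x k) (hk : Centered N d d' k l) : False := by
  have key : ∃ v q u, Moves N d d' v q u k := by
    rcases hx with ⟨v, u, hm⟩ | ⟨v, u, hm⟩
    · exact ⟨_, _, _, hm⟩
    · exact ⟨_, _, _, hm⟩
  obtain ⟨v, q, u, hm⟩ := key
  rcases hk with ⟨v', u', hm'⟩ | ⟨v', u', hm'⟩
  · exact hm.center_not_source h hm'
  · exact hm.swap.center_not_source h.swap hm'.swap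

theorem Moves.mover_not_centered (h : NearlyEqual N d d') {v q u p l : V}
    (hm : Moves N d d' v q u p) (hv : Centered N d d' v l) : False := by
  rcases hv with ⟨v', u', hm'⟩ | ⟨v', u', hm'⟩
  · exact hm.mover_not_source h hm'
  · exact hm.mover_not_target h hm'

end NearlyEqual

/-- A partial injection `R` that preserves a partial colouring `C` extends to an injection that
preserves `C` and fixes the uncoloured elements. -/
theorem exists_injective_extension [Finite V] (R C : V → V → Prop)
    (hR : ∀ q u u', R q u → R q u' → u = u') (hR' : ∀ q q' u, R q u → R q' u → q = q')
    (hC : ∀ x k k', C x k → C x k' → k = k') (hRC : ∀ q u, R q u → ∃ k, C q k ∧ C u k) :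
    ∃ σ : V → V, σ.Injective ∧ (∀ q u, R q u → σ q = u) ∧ (∀ x k, C x k → C (σ x) k) ∧
      ∀ x, (¬ ∃ k, C x k) → σ x = x := by
  classical
  have := Fintype.ofFinite V
  -- `R` respects colours, so within each finite colour class it is a partial injection and extends
  -- to a permutation.
  have key : ∀ k, ∃ g : {x // C x k} → V, g.Injective ∧ (∀ x, C (g x) k) ∧
      ∀ x u, R x.1 u → g x = u := by
    intro k
    let t : Finset V := Finset.univ.filter (C · k)
    let s : Set {x // C x k} := {x | ∃ u, R x.1 u}
    let f : {x // C x k} → V := fun x => if hx : ∃ u, R x.1 u then hx.choose else x.1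
    have hf : ∀ x : {x // C x k}, ∀ u, R x.1 u → f x = u := by
      intro x u hu
      have hx : ∃ u, R x.1 u := ⟨u, hu⟩
      simp only [f, hx, dite_true]
      exact hR _ _ _ hx.choose_spec hu
    have hmaps : s.MapsTo f t := by
      rintro x ⟨u, hu⟩
      rw [hf x u hu]
      obtain ⟨k', h1, h2⟩ := hRC _ _ hu
      have := hC _ _ _ h1 x.2
      subst this
      simpa [t] using h2
    have hinj : s.InjOn f := by
      rintro x ⟨u, hu⟩ y ⟨w, hw⟩ hxy
      rw [hf x u hu, hf y w hw] at hxy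
      subst hxy
      exact Subtype.ext (hR' _ _ _ hu hw)
    obtain ⟨g, hg⟩ := hmaps.exists_equiv_extend_of_card_eq
      (by simp [t, Fintype.card_subtype]) hinj
    refine ⟨fun x => g x, fun x y hxy => g.injective (Subtype.ext hxy), fun x => ?_, ?_⟩
    · exact (Finset.mem_filter.1 (g x).2).2
    · intro x u hu
      exact (hg x ⟨u, hu⟩).trans (hf x u hu)
  choose g hg1 hg2 hg3 using key
  let σ : V → V := fun x => if hx : ∃ k, C x k then g hx.choose ⟨x, hx.choose_spec⟩ else x
  have hσ : ∀ x k (hx : C x k), σ x = g k ⟨x, hx⟩ := by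
    intro x k hx
    have hx' : ∃ k, C x k := ⟨k, hx⟩
    have e : hx'.choose = k := hC _ _ _ hx'.choose_spec hx
    simp only [σ, hx', dite_true]
    congr!
  have hσ' : ∀ x, (¬ ∃ k, C x k) → σ x = x := fun x hx => by simp only [σ, hx, dite_false]
  have hσC : ∀ x k, C x k → C (σ x) k := fun x k hx => by
    rw [hσ x k hx]
    exact hg2 k _
  refine ⟨σ, ?_, ?_, hσC, hσ'⟩
  · intro x y hxy
    by_cases hx : ∃ k, C x k
    · obtain ⟨k, hx⟩ := hx
      by_cases hy : ∃ k, C y k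
      · obtain ⟨l, hy⟩ := hy
        have e : k = l := hC _ _ _ (hσC x k hx) (hxy ▸ hσC y l hy)
        subst e
        rw [hσ x k hx, hσ y k hy] at hxy
        exact congrArg Subtype.val (hg1 k hxy)
      · rw [hσ' y hy] at hxy
        exact absurd ⟨k, hxy ▸ hσC x k hx⟩ hy
    · by_cases hy : ∃ k, C y k
      · obtain ⟨l, hy⟩ := hy
        rw [hσ' x hx] at hxy
        exact absurd ⟨l, hxy ▸ hσC y l hy⟩ hx
      · rwa [hσ' x hx, hσ' y hy] at hxy
  · intro q u hu
    obtain ⟨k, h1, -⟩ := hRC _ _ hu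
    rw [hσ q k h1]
    exact hg3 k _ u hu

/-- The image of `T` is a connected spanning subgraph of `T'`, and a tree is minimal among connected
graphs. -/
theorem SimpleGraph.IsTree.nonempty_iso_of_injective [Finite V] {T T' : SimpleGraph V}
    (hT : T.IsTree) (hT' : T'.IsTree) {σ : V → V} (hσ : σ.Injective)
    (hadj : ∀ x y, T.Adj x y → T'.Adj (σ x) (σ y)) : Nonempty (T ≃g T') := by
  let e : V ≃ V := Equiv.ofBijective σ (Finite.injective_iff_bijective.1 hσ)
  have hle : T.map e.toEmbedding ≤ T' := by
    rintro x y ⟨-, a, b, hab, rfl, rfl⟩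
    exact hadj a b hab
  have hc : (T.map e.toEmbedding).Connected := (Iso.map e T).connected_iff.1 hT.connected
  have heq : T.map e.toEmbedding = T' :=
    le_antisymm hle ((isTree_iff_minimal_connected.1 hT').2 hc hle)
  rw [← heq]
  exact ⟨Iso.map e T⟩

-- `σ` sends sources to targets, permutes the vertices belonging to each centre and fixes all
-- others. A lost edge `v q` becomes the new edge `v u`. A kept edge at a centred vertex leads to
-- its centre, so its image is again an edge; the other kept edges are fixed.
open NearlyEqual in
theorem NearlyEqual.nonempty_iso [Finite V] {N : V → V → Prop} {T T' : SimpleGraph V}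
    (hT : T.IsTree) (hT' : T'.IsTree) (h : NearlyEqual N T.dist T'.dist) :
    Nonempty (T ≃g T') := by
  obtain ⟨σ, hinj, hσR, hσC, hσ⟩ := exists_injective_extension
    (fun q u => ∃ v p, Moves N T.dist T'.dist v q u p) (Centered N T.dist T'.dist)
    (fun q u u' ⟨v, p, hm⟩ ⟨v', p', hm'⟩ => hm.target_unique h hm')
    (fun q q' u ⟨v, p, hm⟩ ⟨v', p', hm'⟩ => hm.swap.target_unique h.swap hm'.swap)
    (fun x k k' hk hk' => hk'.unique h hk)
    (fun q u ⟨v, p, hm⟩ => ⟨p, Or.inl ⟨v, u, hm⟩, Or.inr ⟨v, q, hm⟩⟩)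
  refine hT.nonempty_iso_of_injective hT' hinj fun x y hxy => ?_
  rw [← SimpleGraph.dist_eq_one_iff_adj] at hxy ⊢
  have hs : ∀ a b, T'.dist a b = T'.dist b a := h.right.symm
  have mover : ∀ v q, T.dist v q = 1 → (∃ u p, Moves N T.dist T'.dist v q u p) →
      T'.dist (σ v) (σ q) = 1 := by
    rintro v q - ⟨u, p, hm⟩
    rw [hσR q u ⟨v, p, hm⟩, hσ v (fun ⟨k, hk⟩ => hm.mover_not_centered h hk)]
    exact hm.2.2.2.2.1
  have center : ∀ a b, T.dist a b = 1 → T'.dist a b = 1 → (∃ k, Centered N T.dist T'.dist a k) →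
      T'.dist (σ a) (σ b) = 1 := by
    rintro a b h1 h2 ⟨k, hk⟩
    have := hk.eq_center h h1 h2
    subst this
    rw [hσ b (fun ⟨l, hl⟩ => hk.center_not_centered h hl), hs]
    exact (hσC a b hk).dist_right
  by_cases hxy' : T'.dist x y = 1
  · by_cases hx : ∃ k, Centered N T.dist T'.dist x k
    · exact center x y hxy hxy' hx
    · by_cases hy : ∃ k, Centered N T.dist T'.dist y k
      · rw [hs]
        exact center y x ((h.left.symm _ _).trans hxy) ((hs _ _).trans hxy') hy
      · rw [hσ x hx, hσ y hy]
        exact hxy'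
  · rcases h.swap.exists_moves hxy' hxy with ⟨q, p, hm⟩ | ⟨q, p, hm⟩
    · rw [hs]
      exact mover y x ((h.left.symm _ _).trans hxy) ⟨q, p, hm.swap⟩
    · exact mover x y hxy ⟨q, p, hm.swap⟩

end Iso

/-! ### Diametral pairs, and sufficiency of the degree condition. -/

section MaxDist

variable {V : Type*}

/-- A pair of diametral vertices does not come closer if no diametral pair was queried. -/
theorem NearlyEqual.not_lt_of_forall_le {N : V → V → Prop} {d d' : V → V → ℕ}
    (h : NearlyEqual N d d') {u v : V} (hmax : ∀ a b, d a b ≤ d u v)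
    (hall : ∀ a b, d a b = d u v → N a b) : ¬ d' u v < d u v := by
  intro hlt
  have h4 := h.le_four hlt
  have h1 := h.pos_right hlt
  have h2 := h.mod_two_eq u v
  -- Here `t` hangs from the neighbour `a` of `u` on the path to `v`, hence so does `z`. As `z ≠ a`,
  -- it is at least as far from `v` as `u` is, so `v z` is a queried diametral pair.
  have main : ∀ u v, d' u v + 2 = d u v → (∀ a b, d a b ≤ d u v) →
      (∀ a b, d a b = d u v → N a b) → ¬ ∃ t, ¬ N u t ∧ ¬ N v t ∧ d v t + 2 = d u t + d u v := by
    rintro u v hlt hmax hall ⟨t, t1, t2, t3⟩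
    obtain ⟨a, ha, ha'⟩ := h.left.between u v 1 (by omega)
    obtain ⟨z, z1, z2, -, -, z3, z4⟩ := h.exists_avoiding u v u u a u
    have e := h.class_eq (by omega) z1 z2 t1 t2
    have h0 : d u z ≠ 0 := fun k => z4 ((h.left.eq_zero _ _).1 k).symm
    have h0' : d a z ≠ 0 := fun k => z3 ((h.left.eq_zero _ _).1 k).symm
    have := h.left.symm v a
    have := h.left.fourPoint u v a z
    have := hmax v z
    exact z2 (hall v z (by omega))
  have huv := h.left.symm u v
  have huv' := h.right.symm u v
  obtain ⟨t, t1, t2, -⟩ := h.exists_avoiding u v u u u u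
  have a1 := h.agree _ _ t1
  have a2 := h.agree _ _ t2
  have b1 := h.right.triangle u v t
  have b2 := h.right.triangle v u t
  have b3 := h.left.even u v t
  have hne : d u t ≠ d v t := by
    by_cases k : d u v = 4
    · exact h.class_ne_of_four hlt k t1 t2
    · omega
  by_cases k : d u t < d v t
  · exact main u v (by omega) hmax hall ⟨t, t1, t2, by omega⟩
  · exact main v u (by omega) (fun a b => by rw [← huv]; exact hmax a b)
      (fun a b e => hall a b (by omega)) ⟨t, t2, t1, by omega⟩

namespace SimpleGraph

theorem Connected.dist_hom_le {W : Type*} {T : SimpleGraph V} {T' : SimpleGraph W}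
    (hT : T.Connected) (f : T →g T') (x y : V) : T'.dist (f x) (f y) ≤ T.dist x y := by
  obtain ⟨p, hp⟩ := hT.exists_walk_length_eq_dist x y
  rw [← hp, ← Walk.length_map f p]
  exact dist_le _

variable [Fintype V] {Q : SimpleGraph V} [DecidableRel Q.Adj]

theorem IsTree.nearlyEqual_dist (hV : 13 ≤ Fintype.card V)
    (hQ : ∀ v, Fintype.card V - 3 ≤ Q.degree v) {q : Sym2 V → ℕ} {T T' : SimpleGraph V}
    (hT : IsConsistent Q q T) (hT' : IsConsistent Q q T') :
    NearlyEqual Qᶜ.Adj T.dist T'.dist where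
  left := hT.1.isTreeMetric_dist
  right := hT'.1.isTreeMetric_dist
  symm _ _ h := h.symm
  agree x y hxy := by
    by_cases h : x = y
    · subst h
      simp
    · have hadj : Q.Adj x y := by
        by_contra k
        exact hxy ((compl_adj _ _ _).2 ⟨h, k⟩)
      rw [hT.2 x y hadj, hT'.2 x y hadj]
  few v a b c ha hb hc := by
    classical
    by_contra k
    push Not at k
    have h1 : 2 < (Qᶜ.neighborFinset v).card := Finset.two_lt_card.2
      ⟨a, by simpa using ha, b, by simpa using hb, c, by simpa using hc, k.1, k.2.1, k.2.2⟩
    rw [card_neighborFinset_eq_degree, degree_compl] at h1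
    have := hQ v
    omega
  large s hs := by
    by_contra k
    push Not at k
    have : s = Finset.univ := Finset.eq_univ_of_forall k
    subst this
    rw [Finset.card_univ] at hs
    omega

theorem determinesUpToIso_of_le_degree (hV : 13 ≤ Fintype.card V)
    (hQ : ∀ v, Fintype.card V - 3 ≤ Q.degree v) : DeterminesUpToIso Q :=
  fun _ _ _ hT hT' => NearlyEqual.nonempty_iso hT.1 hT'.1 (IsTree.nearlyEqual_dist hV hQ hT hT')

theorem findsMaxDistPair_of_le_degree (hV : 13 ≤ Fintype.card V)
    (hQ : ∀ v, Fintype.card V - 3 ≤ Q.degree v) : FindsMaxDistPair Q := by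
  rintro q ⟨T, hT⟩
  have : Nonempty V := Fintype.card_pos_iff.1 (by omega)
  obtain ⟨⟨u, v⟩, huv⟩ := Finite.exists_max fun p : V × V => T.dist p.1 p.2
  have hmax : ∀ a b, T.dist a b ≤ T.dist u v := fun a b => huv (a, b)
  have hmax' : ∀ T', IsConsistent Q q T' → ∀ a b, T'.dist a b ≤ T.dist u v := by
    intro T' hT' a b
    obtain ⟨e⟩ := determinesUpToIso_of_le_degree hV hQ q T' T hT' hT
    have h1 := hT.1.connected.dist_hom_le e.symm.toHom (e a) (e b)
    have h2 : T'.dist a b ≤ T.dist (e a) (e b) := by simpa using h1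
    exact h2.trans (hmax _ _)
  by_cases hq : ∃ x y, T.dist x y = T.dist u v ∧ Q.Adj x y
  · obtain ⟨x, y, hxy, hadj⟩ := hq
    refine ⟨x, y, fun T' hT' a b => ?_⟩
    rw [hT'.2 x y hadj, ← hT.2 x y hadj, hxy]
    exact hmax' T' hT' a b
  · push Not at hq
    refine ⟨u, v, fun T' hT' a b => ?_⟩
    refine (hmax' T' hT' a b).trans (not_lt.1 ?_)
    refine (IsTree.nearlyEqual_dist hV hQ hT hT').not_lt_of_forall_le hmax fun x y hxy => ?_
    refine (compl_adj _ _ _).2 ⟨?_, hq x y hxy⟩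
    -- The pair is not degenerate because the diameter is positive.
    rintro rfl
    have : Nontrivial V := Fintype.one_lt_card_iff_nontrivial.1 (by omega)
    obtain ⟨y, hy⟩ := exists_ne x
    have := hT.1.connected.pos_dist_of_ne hy
    have := hmax y x
    rw [dist_self] at hxy
    omega

end SimpleGraph

end MaxDist

/-! ### Spiders and their distances. -/

section Counterexample

variable {V : Type*}

namespace SimpleGraph

/-- A certificate for distances to `z`: the Lipschitz bound gives `f ≤ dist`, and descending along
`f` gives a walk of length `f x`. -/
theorem reachable_and_dist_eq {T : SimpleGraph V} {z : V} (f : V → ℕ) (hz : f z = 0)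
    (hlip : ∀ x y, T.Adj x y → f x ≤ f y + 1)
    (hstep : ∀ x, x ≠ z → ∃ y, T.Adj x y ∧ f y + 1 = f x) (x : V) :
    T.Reachable x z ∧ T.dist x z = f x := by
  have hle : ∀ {x z} (p : T.Walk x z), f x ≤ f z + p.length := by
    intro x z p
    induction p with
    | nil => simp
    | cons h p ih =>
      have := hlip _ _ h
      simp only [Walk.length_cons]
      omega
  have hwalk : ∀ n x, f x = n → ∃ p : T.Walk x z, p.length ≤ n := by
    intro n
    induction n with
    | zero =>
      intro x hx
      by_cases hxz : x = z
      · subst hxz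
        exact ⟨Walk.nil, le_rfl⟩
      · obtain ⟨y, -, hy⟩ := hstep x hxz
        omega
    | succ n ih =>
      intro x hx
      obtain ⟨y, hxy, hy⟩ := hstep x (by rintro rfl; omega)
      obtain ⟨p, hp⟩ := ih y (by omega)
      exact ⟨Walk.cons hxy p, by simpa using hp⟩
  obtain ⟨p, hp⟩ := hwalk _ x rfl
  refine ⟨p.reachable, le_antisymm ((dist_le p).trans hp) ?_⟩
  obtain ⟨p', hp'⟩ := p.reachable.exists_walk_length_eq_dist
  have := hle p'
  omega

/-- Every edge joins a non-root vertex to its parent, so a connected graph of this form has exactly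
one edge fewer than vertices. -/
theorem Connected.isTree_of_parent [Finite V] {T : SimpleGraph V} (hT : T.Connected) (w : V)
    (par : V → V) (hpar : ∀ x y, T.Adj x y → (x ≠ w ∧ par x = y) ∨ (y ≠ w ∧ par y = x)) :
    T.IsTree := by
  classical
  have := Fintype.ofFinite V
  rw [isTree_iff_connected_and_card]
  refine ⟨hT, le_antisymm ?_ hT.card_vert_le_card_edgeSet_add_one⟩
  have hsub : T.edgeSet ⊆ ((Finset.univ.erase w).image fun x => s(x, par x) : Finset (Sym2 V)) := by
    intro e he
    induction e with
    | _ x y =>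
      simp only [Finset.coe_image, Set.mem_image, Finset.mem_coe, Finset.mem_erase]
      rcases hpar x y he with ⟨h1, h2⟩ | ⟨h1, h2⟩
      · exact ⟨x, ⟨h1, Finset.mem_univ _⟩, by rw [h2]⟩
      · exact ⟨y, ⟨h1, Finset.mem_univ _⟩, by rw [h2, Sym2.eq_swap]⟩
  have h1 : Nat.card T.edgeSet ≤ (Finset.univ.erase w).card := by
    rw [Nat.card_coe_set_eq]
    refine (Set.ncard_le_ncard hsub (Finset.finite_toSet _)).trans ?_
    rw [Set.ncard_coe_finset]
    exact Finset.card_image_le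
  rw [Finset.card_erase_of_mem (Finset.mem_univ w), Finset.card_univ] at h1
  have : 0 < Fintype.card V := Fintype.card_pos_iff.2 ⟨w⟩
  rw [Nat.card_eq_fintype_card (α := V)]
  omega

section Spider

variable [DecidableEq V] (w a b v s : V)

/-- The parents in the tree with root `w` in which `b` hangs from `a`, `v` hangs from `s`, and the
other vertices hang from the root. -/
def spiderParent (x : V) : V := if x = b then a else if x = v then s else w

/-- The tree with root `w` in which `b` hangs from `a`, `v` hangs from `s`, and the other vertices
hang from the root. -/
def spider : SimpleGraph V := fromRel fun x y => x ≠ w ∧ spiderParent w a b v s x = y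

/-- The distances in `spider`. -/
def spiderDist (x y : V) : ℕ :=
  let branch (x : V) : V := if x = b then a else if x = v then s else x
  let height (x : V) : ℕ := if x = w then 0 else if x = b ∨ x = v then 2 else 1
  -- Distinct vertices of equal height in one branch occur only for `s = a`: they are `b` and `v`.
  if x = y then 0 else if branch x = branch y then (if height x = height y then 2 else 1)
  else height x + height y

variable {w a b v s : V}

theorem spider_dist (hwa : w ≠ a) (hwb : w ≠ b) (hwv : w ≠ v) (hws : w ≠ s) (hab : a ≠ b)
    (hav : a ≠ v) (hbv : b ≠ v) (hsb : s ≠ b) (hsv : s ≠ v) (x z : V) :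
    (spider w a b v s).Reachable x z ∧
      (spider w a b v s).dist x z = spiderDist w a b v s x z := by
  refine reachable_and_dist_eq (fun x => spiderDist w a b v s x z) ?_ ?_ ?_ x
  · simp [spiderDist]
  · intro x y hxy
    have key : ∀ x, x ≠ w → spiderDist w a b v s x z ≤
        spiderDist w a b v s (spiderParent w a b v s x) z + 1 ∧
        spiderDist w a b v s (spiderParent w a b v s x) z ≤ spiderDist w a b v s x z + 1 := by
      intro x hx
      by_cases hxb : x = b
      · subst hxb
        simp only [spiderParent, spiderDist, if_true]
        grind (splits := 20)
      by_cases hxv : x = v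
      · subst hxv
        simp only [spiderParent, spiderDist, if_true, if_neg hxb]
        grind (splits := 20)
      simp only [spiderParent, spiderDist, if_neg hxb, if_neg hxv]
      grind (splits := 20)
    simp only [spider, fromRel_adj] at hxy
    rcases hxy.2 with ⟨h1, h2⟩ | ⟨h1, h2⟩
    · rw [← h2]
      exact (key x h1).1
    · rw [← h2]
      exact (key y h1).2
  · intro x hxz
    -- The step towards `z` goes down exactly when `x` is an ancestor of `z`, and otherwise to the
    -- parent.
    by_cases h : (x = a ∧ z = b) ∨ (x = s ∧ z = v) ∨ x = w
    · refine ⟨if x = w then (if z = b then a else if z = v then s else z) else z, ?_, ?_⟩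
      · simp only [spider, fromRel_adj, spiderParent]
        grind
      · simp only [spiderDist]
        grind
    · refine ⟨spiderParent w a b v s x, ?_, ?_⟩
      · simp only [spider, fromRel_adj, spiderParent]
        grind
      · simp only [spiderDist, spiderParent]
        grind

end Spider

end SimpleGraph

end Counterexample

/-! ### Necessity of the degree condition. -/

section Necessity

variable {V : Type*}

namespace SimpleGraph

theorem spider_isTree [Finite V] [DecidableEq V] {w a b v s : V} (hwa : w ≠ a) (hwb : w ≠ b)
    (hwv : w ≠ v) (hws : w ≠ s) (hab : a ≠ b) (hav : a ≠ v) (hbv : b ≠ v) (hsb : s ≠ b)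
    (hsv : s ≠ v) : (spider w a b v s).IsTree := by
  have : Nonempty V := ⟨w⟩
  refine Connected.isTree_of_parent ⟨fun x y =>
    (spider_dist hwa hwb hwv hws hab hav hbv hsb hsv x y).1⟩ w (spiderParent w a b v s) ?_
  intro x y hxy
  simp only [spider, fromRel_adj] at hxy
  exact hxy.2

/-- Moving `v` from `a` to `c` is not detected if `v` was not queried with `a`, `b` and `c`. -/
theorem exists_isConsistent_of_not_adj [Fintype V] (hV : 13 ≤ Fintype.card V) {Q : SimpleGraph V}
    {v a b c : V} (ha : ¬ Q.Adj v a) (hb : ¬ Q.Adj v b) (hc : ¬ Q.Adj v c)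
    (hva : v ≠ a) (hvb : v ≠ b) (hvc : v ≠ c) (hab : a ≠ b) (hac : a ≠ c) (hbc : b ≠ c) :
    ∃ q T T', IsConsistent Q q T ∧ IsConsistent Q q T' ∧ (∀ x y, T.dist x y ≤ 3) ∧
      (∃ x y, T.dist x y = 3) ∧ T'.dist b v = 4 ∧
      ∀ x y, 4 ≤ T'.dist x y → T.dist x y = 2 := by
  classical
  obtain ⟨w, hw⟩ : ∃ w, w ∉ [v, a, b, c].toFinset := by
    by_contra k
    push Not at k
    have h1 : [v, a, b, c].toFinset = Finset.univ := Finset.eq_univ_of_forall k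
    have h2 := List.toFinset_card_le [v, a, b, c]
    rw [h1, Finset.card_univ] at h2
    simp only [List.length_cons, List.length_nil] at h2
    omega
  simp only [List.mem_toFinset, List.mem_cons, List.not_mem_nil, or_false, not_or] at hw
  obtain ⟨hwv, hwa, hwb, hwc⟩ := hw
  have hT := spider_isTree hwa hwb hwv hwa hab hva.symm hvb.symm hab hva.symm
  have hT' := spider_isTree hwa hwb hwv hwc hab hva.symm hvb.symm hbc.symm hvc.symm
  have hd := fun x y =>
    (spider_dist hwa hwb hwv hwa hab hva.symm hvb.symm hab hva.symm x y).2
  have hd' := fun x y =>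
    (spider_dist hwa hwb hwv hwc hab hva.symm hvb.symm hbc.symm hvc.symm x y).2
  -- Only the distances from `v` to `a`, `b`, `c` differ: 1, 2, 3 in the first tree and 3, 4, 1 in
  -- the second. The diameters are 3 and 4, the latter attained only by `b` and `v`.
  refine ⟨Sym2.lift ⟨(spider w a b v a).dist, fun _ _ => dist_comm⟩, spider w a b v a,
    spider w a b v c, ⟨hT, fun x y _ => rfl⟩, ⟨hT', fun x y hxy => ?_⟩, fun x y => ?_,
    ⟨b, c, ?_⟩, ?_, fun x y h => ?_⟩
  · change (spider w a b v c).dist x y = (spider w a b v a).dist x y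
    rw [hd, hd']
    by_cases hx : x = v
    · subst hx
      have hya : y ≠ a := by rintro rfl; exact ha hxy
      have hyb : y ≠ b := by rintro rfl; exact hb hxy
      have hyc : y ≠ c := by rintro rfl; exact hc hxy
      simp only [spiderDist]
      grind (splits := 20)
    by_cases hy : y = v
    · subst hy
      have hya : x ≠ a := by rintro rfl; exact ha hxy.symm
      have hyb : x ≠ b := by rintro rfl; exact hb hxy.symm
      have hyc : x ≠ c := by rintro rfl; exact hc hxy.symm
      simp only [spiderDist]
      grind (splits := 20)
    simp only [spiderDist, if_neg hx, if_neg hy]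
  · rw [hd]
    simp only [spiderDist]
    grind (splits := 20)
  · rw [hd]
    simp only [spiderDist]
    grind (splits := 20)
  · rw [hd']
    simp only [spiderDist]
    grind (splits := 20)
  · rw [hd'] at h
    rw [hd]
    have key : (x = b ∧ y = v) ∨ (x = v ∧ y = b) := by
      simp only [spiderDist] at h
      grind (splits := 20)
    simp only [spiderDist]
    grind (splits := 20)

variable [Fintype V] {Q : SimpleGraph V} [DecidableRel Q.Adj]

theorem exists_isConsistent_of_degree_lt (hV : 13 ≤ Fintype.card V)
    (hQ : ¬ ∀ v, Fintype.card V - 3 ≤ Q.degree v) :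
    ∃ q T T', IsConsistent Q q T ∧ IsConsistent Q q T' ∧ (∀ x y, T.dist x y ≤ 3) ∧
      (∃ x y, T.dist x y = 3) ∧ (∃ x y, T'.dist x y = 4) ∧
      ∀ x y, 4 ≤ T'.dist x y → T.dist x y = 2 := by
  classical
  push Not at hQ
  obtain ⟨v, hv⟩ := hQ
  have h1 : 2 < (Qᶜ.neighborFinset v).card := by
    rw [card_neighborFinset_eq_degree, degree_compl]
    omega
  obtain ⟨a, ha, b, hb, c, hc, hab, hac, hbc⟩ := Finset.two_lt_card.1 h1
  rw [mem_neighborFinset, compl_adj] at ha hb hc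
  obtain ⟨q, T, T', h1, h2, h3, h4, h5, h6⟩ := exists_isConsistent_of_not_adj hV ha.2 hb.2 hc.2
    ha.1 hb.1 hc.1 hab hac hbc
  exact ⟨q, T, T', h1, h2, h3, h4, ⟨b, v, h5⟩, h6⟩

theorem findsMaxDistPair_iff (hV : 13 ≤ Fintype.card V) :
    FindsMaxDistPair Q ↔ ∀ v, Fintype.card V - 3 ≤ Q.degree v := by
  refine ⟨fun h => ?_, findsMaxDistPair_of_le_degree hV⟩
  by_contra hQ
  obtain ⟨q, T, T', h1, h2, -, ⟨x, y, h4⟩, ⟨x', y', h5⟩, h6⟩ :=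
    exists_isConsistent_of_degree_lt hV hQ
  obtain ⟨u, v, huv⟩ := h q ⟨T, h1⟩
  have k1 := huv T h1 x y
  have k2 := huv T' h2 x' y'
  have := h6 u v (by omega)
  omega

theorem determinesUpToIso_iff (hV : 13 ≤ Fintype.card V) :
    DeterminesUpToIso Q ↔ ∀ v, Fintype.card V - 3 ≤ Q.degree v := by
  refine ⟨fun h => ?_, determinesUpToIso_of_le_degree hV⟩
  by_contra hQ
  obtain ⟨q, T, T', h1, h2, h3, -, ⟨x, y, h5⟩, -⟩ := exists_isConsistent_of_degree_lt hV hQ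
  obtain ⟨e⟩ := h q T T' h1 h2
  have k := h1.1.connected.dist_hom_le e.toHom (e.symm x) (e.symm y)
  have k1 : T'.dist x y ≤ T.dist (e.symm x) (e.symm y) := by simpa using k
  have := h3 (e.symm x) (e.symm y)
  omega

end SimpleGraph

end Necessity

/-! ### The minimum number of queries. -/

section Count

open SimpleGraph

/-- The complement of an n-cycle is (n-3)-regular, so it satisfies `P`, and the handshake lemma
shows that it has the fewest edges. -/
theorem sInf_ncard_edgeSet (n : ℕ) (hn : 13 ≤ n) (P : SimpleGraph (Fin n) → Prop)
    (hP : ∀ (Q : SimpleGraph (Fin n)) [DecidableRel Q.Adj], P Q ↔ ∀ v, n - 3 ≤ Q.degree v) :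
    ((sInf {m | ∃ Q : SimpleGraph (Fin n), P Q ∧ Q.edgeSet.ncard = m} : ℕ) : ℚ) =
      (n : ℚ) * ((n : ℚ) - 3) / 2 := by
  classical
  have hcount : ∀ (Q : SimpleGraph (Fin n)) [DecidableRel Q.Adj],
      ∑ v, Q.degree v = 2 * Q.edgeSet.ncard := fun Q _ => by
    rw [sum_degrees_eq_twice_card_edges, ← Set.ncard_coe_finset, coe_edgeFinset]
  obtain ⟨C, hC⟩ : ∃ C : SimpleGraph (Fin n), ∀ v, Cᶜ.degree v = n - 3 := by
    obtain ⟨m, rfl⟩ : ∃ m, n = m + 3 := ⟨n - 3, by omega⟩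
    refine ⟨cycleGraph (m + 3), fun v => ?_⟩
    rw [degree_compl, Fintype.card_fin]
    have := cycleGraph_degree_three_le (n := m) (v := v)
    simp only [← card_neighborSet_eq_degree, ← Nat.card_eq_fintype_card] at this ⊢
    omega
  have hsInf : IsLeast {m | ∃ Q : SimpleGraph (Fin n), P Q ∧ Q.edgeSet.ncard = m}
      Cᶜ.edgeSet.ncard := by
    refine ⟨⟨Cᶜ, (hP _).2 fun v => (hC v).ge, rfl⟩, ?_⟩
    rintro m ⟨Q, hQ, rfl⟩
    have h1 := Finset.sum_le_sum fun v (_ : v ∈ Finset.univ) => ((hC v).le.trans ((hP Q).1 hQ v))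
    rw [hcount, hcount] at h1
    omega
  rw [hsInf.csInf_eq]
  have h := hcount Cᶜ
  simp only [hC, Finset.sum_const, Finset.card_univ, Fintype.card_fin, smul_eq_mul] at h
  have h' : ((n * (n - 3) : ℕ) : ℚ) = ((2 * Cᶜ.edgeSet.ncard : ℕ) : ℚ) := by rw [h]
  rw [Nat.cast_mul, Nat.cast_sub (by omega)] at h'
  push_cast at h'
  linarith

end Count

theorem mainTheorem2 (n : ℕ) (hn : 13 ≤ n) :
    (∀ (Q : SimpleGraph (Fin n)) [DecidableRel Q.Adj],
      (FindsMaxDistPair Q ↔ ∀ v, n - 3 ≤ Q.degree v) ∧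
      (DeterminesUpToIso Q ↔ ∀ v, n - 3 ≤ Q.degree v)) ∧
    (fN n : ℚ) = (n : ℚ) * ((n : ℚ) - 3) / 2 ∧
    (hN n : ℚ) = (n : ℚ) * ((n : ℚ) - 3) / 2 := by
  have hV : 13 ≤ Fintype.card (Fin n) := by simpa using hn
  have h1 : ∀ (Q : SimpleGraph (Fin n)) [DecidableRel Q.Adj],
      FindsMaxDistPair Q ↔ ∀ v, n - 3 ≤ Q.degree v := fun Q _ => by
    simpa using SimpleGraph.findsMaxDistPair_iff (Q := Q) hV
  have h2 : ∀ (Q : SimpleGraph (Fin n)) [DecidableRel Q.Adj],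
      DeterminesUpToIso Q ↔ ∀ v, n - 3 ≤ Q.degree v := fun Q _ => by
    simpa using SimpleGraph.determinesUpToIso_iff (Q := Q) hV
  exact ⟨fun Q _ => ⟨h1 Q, h2 Q⟩, sInf_ncard_edgeSet n hn _ h1, sInf_ncard_edgeSet n hn _ h2⟩
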